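/- Let $\mathfrak{A}$ be a $C^*$-algebra and let $\mathscr{H}$ be a Hilbert $\mathfrak{A}$-module. Let $\mathcal{L}(\mathscr{H})$ be the $C^*$-algebra of adjointable operators on $\mathscr{H}$, that is, of the operators $T:\mathscr{H}\to\mathscr{H}$ for which there is an operator $T^*:\mathscr{H}\to\mathscr{H}$ with $\langle Tx,y\rangle=\langle x,T^*y\rangle$ for all $x,y\in\mathscr{H}$, equipped with the operator norm. Let $P,Q\in\mathcal{L}(\mathscr{H})$ be two projections, that is, $P=P^2=P^*$ and $Q=Q^2=Q^*$. Then for any $\varepsilon\in(0,1)$ there exists a projection $Q'\in\mathcal{L}(\mathscr{H})$ such that $\|Q-Q'\|<\varepsilon$ and the equation $$(P+Q')^{1/2}X=P,\qquad X\in\mathcal{L}(\mathscr{H}),$$ has a solution, where $(P+Q')^{1/2}$ is the positive square root of the positive element $P+Q'$ of $\mathcal{L}(\mathscr{H})$. -/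

import Mathlib

/-!
Hilbert C⋆-modules are Mathlib's `CStarModule A E` over an arbitrary (possibly non-unital)
C⋆-algebra `A`, complete in the norm `‖x‖ = ‖⟪x, x⟫‖ ^ (1/2)`. This file builds the C⋆-algebra
`L(E)` of adjointable operators on `E`, with the operator norm and the adjoint as involution.
-/

section AdjointableOperators

set_option linter.unusedSectionVars false

variable (A : Type*) (E : Type*) [NonUnitalCStarAlgebra A] [PartialOrder A] [StarOrderedRing A]
  [NormedAddCommGroup E] [NormedSpace ℂ E] [SMul A E] [CStarModule A E]

/-- The adjointable operators on a Hilbert C⋆-module `E`, as a subalgebra of the bounded linear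
operators: the operators `T` for which there is an operator `S` on `E` with
`⟪T x, y⟫ = ⟪x, S y⟫` for all `x, y`. On a complete `E` every map with an adjoint is automatically
`ℂ`-linear, `A`-linear and bounded, so that nothing is lost (see `AdjointableOp.exists_of_inner`). -/
def adjointable : Subalgebra ℂ (E →L[ℂ] E) where
  carrier := {T | ∃ S : E →L[ℂ] E, ∀ x y : E, inner A (T x) y = inner A x (S y)}
  mul_mem' := by
    rintro T T' ⟨S, hS⟩ ⟨S', hS'⟩
    exact ⟨S' * S, fun x y => by simp [hS, hS']⟩
  add_mem' := by
    rintro T T' ⟨S, hS⟩ ⟨S', hS'⟩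
    exact ⟨S + S', fun x y => by simp [hS, hS']⟩
  algebraMap_mem' c := ⟨star c • 1, fun x y => by simp [Algebra.algebraMap_eq_smul_one]⟩

/-- `L(E)`, the type of adjointable operators on a Hilbert C⋆-module `E`. -/
def AdjointableOp : Type _ := ↥(adjointable A E)

namespace AdjointableOp

/-- `L(E)` is a normed ring under composition and the operator norm. -/
noncomputable instance : NormedRing (AdjointableOp A E) :=
  inferInstanceAs (NormedRing (adjointable A E))

noncomputable instance : NormedAlgebra ℂ (AdjointableOp A E) :=
  inferInstanceAs (NormedAlgebra ℂ (adjointable A E))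

variable {A E}

lemma ext_inner_right {u v : E} (h : ∀ x : E, inner A x u = inner A x v) : u = v := by
  rw [← sub_eq_zero, ← CStarModule.inner_self (A := A), CStarModule.inner_sub_right, h, sub_self]

/-- The bounded linear operator underlying an adjointable operator. -/
def toCLM (T : AdjointableOp A E) : E →L[ℂ] E := T.1

@[ext] lemma ext {T S : AdjointableOp A E} (h : ∀ x, T.toCLM x = S.toCLM x) : T = S :=
  Subtype.ext (ContinuousLinearMap.ext h)

@[simp] lemma toCLM_mul (T S : AdjointableOp A E) : (T * S).toCLM = T.toCLM * S.toCLM := rfl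
@[simp] lemma toCLM_one : (1 : AdjointableOp A E).toCLM = 1 := rfl
@[simp] lemma toCLM_add (T S : AdjointableOp A E) : (T + S).toCLM = T.toCLM + S.toCLM := rfl
@[simp] lemma toCLM_smul (c : ℂ) (T : AdjointableOp A E) : (c • T).toCLM = c • T.toCLM := rfl
lemma norm_toCLM (T : AdjointableOp A E) : ‖T.toCLM‖ = ‖T‖ := rfl

/-- The adjoint `T⋆` of an adjointable operator `T`. -/
noncomputable instance : Star (AdjointableOp A E) where
  star T := ⟨T.2.choose, T.1, fun x y => by
    rw [← CStarModule.star_inner, ← T.2.choose_spec, CStarModule.star_inner]⟩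

/-- The defining property of the adjoint, `⟪T x, y⟫ = ⟪x, T⋆ y⟫`. -/
lemma inner_left (T : AdjointableOp A E) (x y : E) :
    inner A (T.toCLM x) y = inner A x ((star T).toCLM y) := T.2.choose_spec x y

lemma star_eq_of_inner {T S : AdjointableOp A E}
    (h : ∀ x y : E, inner A (T.toCLM x) y = inner A x (S.toCLM y)) : star T = S :=
  ext fun y => ext_inner_right (A := A) fun x => by rw [← inner_left, h]

lemma inner_right (T : AdjointableOp A E) (x y : E) :
    inner A x (T.toCLM y) = inner A ((star T).toCLM x) y := by
  rw [← CStarModule.star_inner, inner_left, CStarModule.star_inner]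

noncomputable instance : StarRing (AdjointableOp A E) where
  star_involutive T := star_eq_of_inner fun x y => (inner_right T x y).symm
  star_mul T S := star_eq_of_inner fun x y => by simp [inner_left]
  star_add T S := star_eq_of_inner fun x y => by simp [inner_left]

instance : StarModule ℂ (AdjointableOp A E) where
  star_smul c T := star_eq_of_inner fun x y => by simp [inner_left]

lemma norm_apply_le (T : AdjointableOp A E) (x : E) : ‖T.toCLM x‖ ≤ ‖T‖ * ‖x‖ :=
  T.toCLM.le_opNorm x

lemma norm_le_of_apply_le (T : AdjointableOp A E) {M : ℝ} (hM : 0 ≤ M)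
    (h : ∀ x, ‖T.toCLM x‖ ≤ M * ‖x‖) : ‖T‖ ≤ M :=
  T.toCLM.opNorm_le_bound hM h

lemma norm_star_le (T : AdjointableOp A E) : ‖star T‖ ≤ ‖T‖ := by
  refine norm_le_of_apply_le _ (norm_nonneg T) fun x => ?_
  set z := (star T).toCLM x with hz
  have h : ‖z‖ * ‖z‖ ≤ (‖T‖ * ‖x‖) * ‖z‖ := by
    calc ‖z‖ * ‖z‖ = ‖inner A x (T.toCLM z)‖ := by
          rw [← pow_two, CStarModule.norm_sq_eq A, inner_right T]
      _ ≤ ‖x‖ * ‖T.toCLM z‖ := CStarModule.norm_inner_le E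
      _ ≤ ‖x‖ * (‖T‖ * ‖z‖) := by gcongr; exact norm_apply_le _ _
      _ = _ := by ring
  rcases (norm_nonneg z).eq_or_lt with h0 | h0
  · rw [← h0]; positivity
  · exact le_of_mul_le_mul_right h h0

instance : CStarRing (AdjointableOp A E) where
  norm_mul_self_le T := by
    have h : ‖T‖ ≤ √‖star T * T‖ := by
      refine norm_le_of_apply_le _ (Real.sqrt_nonneg _) fun x => ?_
      refine (sq_le_sq₀ (norm_nonneg _) (by positivity)).1 ?_
      rw [mul_pow, Real.sq_sqrt (norm_nonneg _)]
      calc ‖T.toCLM x‖ ^ 2 = ‖inner A x ((star T * T).toCLM x)‖ := by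
            rw [CStarModule.norm_sq_eq A, inner_left]; rfl
        _ ≤ ‖x‖ * ‖(star T * T).toCLM x‖ := CStarModule.norm_inner_le E
        _ ≤ ‖x‖ * (‖star T * T‖ * ‖x‖) := by gcongr; exact norm_apply_le _ _
        _ = _ := by ring
    calc ‖T‖ * ‖T‖ ≤ √‖star T * T‖ * √‖star T * T‖ := by gcongr
      _ = _ := Real.mul_self_sqrt (norm_nonneg _)

open Filter Topology in
instance [CompleteSpace E] : CompleteSpace (AdjointableOp A E) := by
  refine Metric.complete_of_cauchySeq_tendsto fun u hu => ?_
  have hs : CauchySeq fun n => star (u n) := by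
    refine Metric.cauchySeq_iff.2 fun ε hε => ?_
    obtain ⟨N, hN⟩ := Metric.cauchySeq_iff.1 hu ε hε
    refine ⟨N, fun m hm n hn => lt_of_le_of_lt ?_ (hN m hm n hn)⟩
    rw [dist_eq_norm, dist_eq_norm, ← star_sub]
    exact norm_star_le _
  have hc : UniformContinuous (toCLM (A := A) (E := E)) := uniformContinuous_subtype_val
  obtain ⟨T, hT⟩ := cauchySeq_tendsto_of_complete (hc.comp_cauchySeq hu)
  obtain ⟨S, hS⟩ := cauchySeq_tendsto_of_complete (hc.comp_cauchySeq hs)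
  have key : ∀ x y : E, inner A (T x) y = inner A x (S y) := fun x y => by
    have h1 : Tendsto (fun n => inner A ((u n).toCLM x) y) atTop (𝓝 (inner A (T x) y)) :=
      ((CStarModule.continuous_inner (A := A) (E := E)).tendsto (T x, y)).comp
        (((ContinuousLinearMap.apply ℂ E x).continuous.tendsto T |>.comp hT).prodMk_nhds
          tendsto_const_nhds)
    have h2 : Tendsto (fun n => inner A x ((star (u n)).toCLM y)) atTop
        (𝓝 (inner A x (S y))) :=
      ((CStarModule.continuous_inner (A := A) (E := E)).tendsto (x, S y)).comp
        (tendsto_const_nhds.prodMk_nhds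
          ((ContinuousLinearMap.apply ℂ E y).continuous.tendsto S |>.comp hS))
    simp only [inner_left] at h1
    exact tendsto_nhds_unique h1 h2
  exact ⟨⟨T, S, key⟩, tendsto_subtype_rng.2 hT⟩

/-- `L(E)` is a unital C⋆-algebra. -/
noncomputable instance [CompleteSpace E] : CStarAlgebra (AdjointableOp A E) where

/-- The order of the C⋆-algebra `L(E)`: `S ≤ T` iff `T - S` is positive, that is, self-adjoint
with spectrum in `[0, ∞)`. -/
noncomputable instance [CompleteSpace E] : PartialOrder (AdjointableOp A E) :=
  CStarAlgebra.spectralOrder _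

instance [CompleteSpace E] : StarOrderedRing (AdjointableOp A E) :=
  CStarAlgebra.spectralOrderedRing _

/-- Any two maps on a Hilbert C⋆-module that are adjoint to each other, with no linearity or
boundedness assumed, belong to `L(E)`. -/
lemma exists_of_inner [CompleteSpace E] (f g : E → E)
    (h : ∀ x y : E, inner A (f x) y = inner A x (g y)) :
    ∃ T : AdjointableOp A E, (∀ x, T.toCLM x = f x) ∧ ∀ x, (star T).toCLM x = g x := by
  have main : ∀ f g : E → E, (∀ x y : E, inner A (f x) y = inner A x (g y)) →
      ∃ S : E →L[ℂ] E, ∀ y, S y = g y := fun f g h => by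
    let L : E →ₗ[ℂ] E :=
      { toFun := g
        map_add' := fun y z => ext_inner_right (A := A) fun x => by
          rw [CStarModule.inner_add_right, ← h, ← h, ← h, CStarModule.inner_add_right]
        map_smul' := fun c y => ext_inner_right (A := A) fun x => by
          rw [← h]; simp [← h] }
    refine ⟨⟨L, L.continuous_of_seq_closed_graph fun u x y hu hL => ?_⟩, fun _ => rfl⟩
    refine ext_inner_right (A := A) fun z => ?_
    have h1 := ((CStarModule.innerSL (A := A) (E := E) z).continuous.tendsto y).comp hL
    have h2 := ((CStarModule.innerSL (A := A) (E := E) (f z)).continuous.tendsto x).comp hu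
    have h3 : (fun n => inner A z (L (u n))) = fun n => inner A (f z) (u n) :=
      funext fun n => (h z (u n)).symm
    exact (tendsto_nhds_unique h1 (by
      simpa [Function.comp_def, CStarModule.innerSL_apply, h3] using h2)).trans (h z x)
  obtain ⟨S, hS⟩ := main f g h
  obtain ⟨T, hT⟩ := main g f fun x y => by
    rw [← CStarModule.star_inner, ← h, CStarModule.star_inner]
  have key : ∀ x y : E, inner A (T x) y = inner A x (S y) := fun x y => by rw [hT, hS, h]
  let T' : AdjointableOp A E := ⟨T, S, key⟩
  refine ⟨T', hT, fun x => ?_⟩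
  rw [star_eq_of_inner (T := T') (S := ⟨S, T, fun x y => by
    rw [← CStarModule.star_inner, ← key, CStarModule.star_inner]⟩) key]
  exact hS x

end AdjointableOp

end AdjointableOperators

/-!
The statement holds in every unital C⋆-algebra; only that structure of `L(E)` is used.

For projections `P`, `Q` with `r = |P - Q|` one has `(P + Q + r)² = 2 (1 + r) (P + Q)`, and `r`
commutes with `P` and `Q`, so `(P + Q)^{1/2} = (2 (1 + r))^{-1/2} (P + Q + r)`. If moreover
`P - Q = r V` for a self-adjoint `V` in the algebra with `P V + V P = r + V` and `r V² = r` (a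
"sign" of `P - Q`), then `(P + Q + r) (1 + V) P = 2 (1 + r) P`, so that
`X = (2 (1 + r))^{-1/2} (1 + V) P` solves `(P + Q)^{1/2} X = P`. This is `exists_sqrt_mul_eq`.

In general a C⋆-algebra contains no such sign, the obstruction sitting near the points where the
angle between `P` and `Q` vanishes. It disappears once small angles are replaced by zero. The
element `z = (P - Q)²` commutes with `P` and `Q`; on the fibre where it takes the value
`t = sin² θ`, `P` and `Q` are, up to degenerate cases, rank one projections in the plane at angle
`θ`. The projection `Q'` is at angle `θ'` from `P` in the same direction, where
`sin² θ' = (t - d²)⁺ / (1 - d²)`. With `J = 2 P - 1`, the difference `P - Q'` is a combination of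
`P - Q` and `J` with coefficients depending on `z`, divisible by `sin θ'`, and the quotient `V`
stays continuous because the direction is only needed where `t ≥ d²`. As `θ'` is uniformly close to `θ`,
so is `Q'` to `Q`.
-/

/-! ### The cutoff functions -/

/-- The sine of the modified angle, as a function of the squared sine `t` of the original one: it
vanishes for `t ≤ d ^ 2` and equals `1` at `t = 1` (for `0 < d < 1`). -/
noncomputable def sineCutoff (d t : ℝ) : ℝ := √(max (t - d ^ 2) 0 / (1 - d ^ 2))

/-- The coefficient of `P - Q` in the sign of `P - Q'`, as a function of the squared sine `t`.
The value on `t ≤ d ^ 2`, where `sineCutoff d t = 0`, plays no role beyond continuity. -/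
noncomputable def offDiagScale (d t : ℝ) : ℝ := (√(max t (d ^ 2) * (1 - d ^ 2)))⁻¹

@[fun_prop] lemma continuous_sineCutoff (d : ℝ) : Continuous (sineCutoff d) := by
  unfold sineCutoff; fun_prop

lemma continuous_offDiagScale {d : ℝ} (hd : 0 < d) (hd1 : d < 1) :
    Continuous (offDiagScale d) := by
  have h1 : 0 < 1 - d ^ 2 := by nlinarith
  refine Continuous.inv₀ (by fun_prop) fun t => ?_
  have : 0 < max t (d ^ 2) := lt_max_of_lt_right (by positivity)
  positivity

lemma sineCutoff_nonneg (d t : ℝ) : 0 ≤ sineCutoff d t := Real.sqrt_nonneg _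

lemma sineCutoff_eq_zero {d t : ℝ} (h : t ≤ d ^ 2) : sineCutoff d t = 0 := by
  simp [sineCutoff, max_eq_right (sub_nonpos.2 h)]

/-- Beyond the cutoff both functions are rational in the three square roots `s = √t`,
`q = √(t - d ^ 2)` and `k = √(1 - d ^ 2)`. -/
lemma exists_cutoff_eq {d t : ℝ} (hd : 0 < d) (hd1 : d < 1) (h : d ^ 2 < t) :
    ∃ s q k : ℝ, 0 < s ∧ 0 ≤ q ∧ 0 < k ∧ s ^ 2 = t ∧ q ^ 2 = t - d ^ 2 ∧ k ^ 2 = 1 - d ^ 2 ∧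
      sineCutoff d t = q / k ∧ offDiagScale d t = (s * k)⁻¹ := by
  have h1 : 0 < 1 - d ^ 2 := by nlinarith
  have ht : 0 < t := (by positivity : 0 < d ^ 2).trans h
  refine ⟨√t, √(t - d ^ 2), √(1 - d ^ 2), by positivity, by positivity, by positivity,
    Real.sq_sqrt ht.le, Real.sq_sqrt (by linarith), Real.sq_sqrt h1.le, ?_, ?_⟩
  · rw [sineCutoff, max_eq_left (by linarith), Real.sqrt_div' _ h1.le]
  · rw [offDiagScale, max_eq_left h.le, Real.sqrt_mul ht.le]

/-- The scalar form of `r V² = r`. -/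
lemma sineCutoff_mul_sq {d : ℝ} (hd : 0 < d) (hd1 : d < 1) (t : ℝ) :
    sineCutoff d t * (offDiagScale d t ^ 2 * (t - t ^ 2) + sineCutoff d t ^ 2) =
      sineCutoff d t := by
  rcases le_or_gt t (d ^ 2) with h | h
  · simp [sineCutoff_eq_zero h]
  · obtain ⟨s, q, k, hs, hq, hk, hst, hqt, hkd, hr, hb⟩ := exists_cutoff_eq hd hd1 h
    suffices offDiagScale d t ^ 2 * (t - t ^ 2) + sineCutoff d t ^ 2 = 1 by rw [this, mul_one]
    rw [hr, hb, inv_pow, mul_pow, div_pow, hst, hqt, hkd]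
    have : 1 - d ^ 2 ≠ 0 := by nlinarith
    have : t ≠ 0 := by nlinarith
    field_simp
    ring

/-- Bounds the component of `Q - Q'` along `P - Q`. -/
lemma sq_sineCutoff_mul_offDiagScale_sub_one_mul_le {d t : ℝ} (hd : 0 < d) (hd2 : d ≤ 1 / 2)
    (ht1 : t ≤ 1) : (sineCutoff d t * offDiagScale d t - 1) ^ 2 * t ≤ (2 * d) ^ 2 := by
  rcases le_or_gt t (d ^ 2) with h | h
  · rw [sineCutoff_eq_zero h]; nlinarith
  · obtain ⟨s, q, k, hs, hq, hk, hst, hqt, hkd, hr, hb⟩ := exists_cutoff_eq hd (by linarith) h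
    have hqs : q ≤ s := by nlinarith
    have hsq : s ≤ q + d := by nlinarith [mul_nonneg hq hd.le]
    have hs1 : s ≤ 1 := by nlinarith
    have hk2 : 3 / 4 ≤ k ^ 2 := by nlinarith
    have e : (sineCutoff d t * offDiagScale d t - 1) ^ 2 * t =
        ((q - s + d ^ 2 * s) / k ^ 2) ^ 2 := by
      have : d ^ 2 = 1 - k ^ 2 := by linarith
      rw [hr, hb, ← hst, this]; field_simp; ring
    rw [e]
    refine sq_le_sq' ?_ ?_
    · rw [le_div_iff₀ (by positivity)]; nlinarith [mul_nonneg (sq_nonneg d) hs.le]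
    · rw [div_le_iff₀ (by positivity)]
      nlinarith [mul_le_mul_of_nonneg_left hs1 (sq_nonneg d)]

/-- Bounds the component of `Q - Q'` along `2 P - 1`. -/
lemma abs_sineCutoff_mul_sub_le {d t : ℝ} (hd : 0 < d) (hd2 : d ≤ 1 / 2)
    (ht1 : t ≤ 1) :
    |sineCutoff d t * (sineCutoff d t - offDiagScale d t * t)| ≤ 2 * d := by
  rcases le_or_gt t (d ^ 2) with h | h
  · rw [sineCutoff_eq_zero h, zero_mul, abs_zero]; positivity
  · obtain ⟨s, q, k, hs, hq, hk, hst, hqt, hkd, hr, hb⟩ := exists_cutoff_eq hd (by linarith) h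
    have hqs : q ≤ s := by nlinarith
    have hsq : s ≤ q + d := by nlinarith [mul_nonneg hq hd.le]
    have hs1 : s ≤ 1 := by nlinarith
    have hk2 : 3 / 4 ≤ k ^ 2 := by nlinarith
    have e : sineCutoff d t * (sineCutoff d t - offDiagScale d t * t) =
        -(q * (s - q) / k ^ 2) := by
      rw [hr, hb, ← hst]; field_simp; ring
    have h1 : 0 ≤ s - q := by linarith
    rw [e, abs_neg, abs_of_nonneg (by positivity), div_le_iff₀ (by positivity)]
    have : q * (s - q) ≤ 1 * d := mul_le_mul (by linarith) (by linarith) h1 zero_le_one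
    nlinarith

/-! ### The square of the difference of two projections -/

section Difference

variable {R : Type*} [Ring R] {P Q : R}

lemma commute_sub_mul_sub (hP : IsIdempotentElem P) (hQ : IsIdempotentElem Q) :
    (P - Q) * (P - Q) * P = P * ((P - Q) * (P - Q)) := by
  have h1 : (P - Q) * (P - Q) * P = P * P * P + Q * Q * P - P * Q * P - Q * (P * P) := by
    noncomm_ring
  have h2 : P * ((P - Q) * (P - Q)) = P * P * P + P * (Q * Q) - P * Q * P - P * P * Q := by
    noncomm_ring
  rw [h1, h2, hQ.eq, hP.eq]; noncomm_ring

lemma mul_sub_add_sub_mul (hP : IsIdempotentElem P) (hQ : IsIdempotentElem Q) :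
    P * (P - Q) + (P - Q) * P = (P - Q) * (P - Q) + (P - Q) := by
  have h1 : P * (P - Q) + (P - Q) * P = 2 * (P * P) - P * Q - Q * P := by noncomm_ring
  have h2 : (P - Q) * (P - Q) + (P - Q) = P * P + Q * Q - P * Q - Q * P + P - Q := by
    noncomm_ring
  rw [h1, h2, hP.eq, hQ.eq]; noncomm_ring

lemma sub_mul_sub_add_mul_self (hP : IsIdempotentElem P) (hQ : IsIdempotentElem Q) :
    (P - Q) * (P - Q) + (P + Q - 1) * (P + Q - 1) = 1 := by
  have h : (P - Q) * (P - Q) + (P + Q - 1) * (P + Q - 1)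
      = 2 * (P * P) + 2 * (Q * Q) - 2 * P - 2 * Q + 1 := by noncomm_ring
  rw [h, hP.eq, hQ.eq]; noncomm_ring

end Difference

/-! ### Solving the equation when the difference of the projections has a sign -/

/-- The relations on `P`, `V`, `r` say that `r * V` is the difference of `P` and another projection,
with absolute value `r` and sign `V`. -/
lemma isStarProjection_sub_mul_of_anticommutator {R : Type*} [Ring R] [StarRing R] {P V r : R}
    (hP : IsStarProjection P) (hV : IsSelfAdjoint V) (hr : IsSelfAdjoint r)
    (hrP : r * P = P * r) (hrV : r * V = V * r) (hanti : P * V + V * P = r + V)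
    (hrVV : r * (V * V) = r) : IsStarProjection (P - r * V) := by
  refine ⟨?_, ?_⟩
  · have hPP : P * P = P := hP.isIdempotentElem
    change (P - r * V) * (P - r * V) = P - r * V
    calc (P - r * V) * (P - r * V)
        = P * P - (P * r) * V - r * (V * P) + r * (V * r) * V := by noncomm_ring
      _ = P - r * (P * V + V * P) + r * (r * (V * V)) := by
          rw [hPP, ← hrP, ← hrV]; noncomm_ring
      _ = P - r * V := by rw [hanti, hrVV]; noncomm_ring
  · exact hP.isSelfAdjoint.sub (hr.commute_iff hV |>.1 hrV)

section PerturbedProjection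

variable {B : Type*} [CStarAlgebra B] [PartialOrder B] [StarOrderedRing B]

/-- The element `m` is `(2 (1 + r))^{-1/2}`. -/
lemma exists_sqrt_inverse {r : B} (hr : 0 ≤ r) :
    ∃ m : B, 0 ≤ m ∧ (∀ a, r * a = a * r → m * a = a * m) ∧ m * m * (2 * (1 + r)) = 1 := by
  have hrs : IsSelfAdjoint r := .of_nonneg hr
  have hne : ∀ x ∈ spectrum ℝ r, √(2 * (1 + x)) ≠ 0 := fun x hx => by
    have := spectrum_nonneg_of_nonneg hr hx
    positivity
  have hc : ContinuousOn (fun x : ℝ => (√(2 * (1 + x)))⁻¹) (spectrum ℝ r) :=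
    ContinuousOn.inv₀ (by fun_prop) hne
  refine ⟨cfc (fun x : ℝ => (√(2 * (1 + x)))⁻¹) r, cfc_nonneg fun x _ => by positivity,
    fun a ha => (Commute.cfc_real (show Commute r a from ha) _).eq, ?_⟩
  have h2 : (2 : B) * (1 + r) = cfc (fun x : ℝ => 2 * (1 + x)) r := by
    rw [cfc_const_mul (2 : ℝ) (fun x : ℝ => 1 + x) r, cfc_const_add (1 : ℝ) (fun x : ℝ => x) r,
      cfc_id' ℝ r, map_one, two_smul, two_mul]
  rw [h2, ← cfc_mul _ _ r hc hc,
    ← cfc_mul (fun x : ℝ => (√(2 * (1 + x)))⁻¹ * (√(2 * (1 + x)))⁻¹) _ r (hc.mul hc) (by fun_prop),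
    ← cfc_const_one ℝ r]
  refine cfc_congr fun x hx => ?_
  have h0 := spectrum_nonneg_of_nonneg hr hx
  have h1 : √(2 * (1 + x)) * √(2 * (1 + x)) = 2 * (1 + x) := Real.mul_self_sqrt (by positivity)
  rw [← mul_inv, h1, inv_mul_cancel₀ (by positivity)]

/-- If the difference `r * V` of the projections `P` and `Q' = P - r * V` has a sign `V`, then
`P = (P + Q')^{1/2} X` is solvable: with `m = (2 (1 + r))^{-1/2}` the square root is
`m (P + Q' + r)`, and `X = m (1 + V) P`. -/
lemma exists_sqrt_mul_eq {P V r : B} (hP : IsStarProjection P)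
    (hV : IsSelfAdjoint V) (hr : 0 ≤ r) (hrP : r * P = P * r) (hrV : r * V = V * r)
    (hanti : P * V + V * P = r + V) (hrVV : r * (V * V) = r) :
    ∃ X : B, CFC.sqrt (P + (P - r * V)) * X = P := by
  have hPP : P * P = P := hP.isIdempotentElem
  have hQ := isStarProjection_sub_mul_of_anticommutator hP hV (.of_nonneg hr) hrP hrV hanti hrVV
  obtain ⟨m, hm0, hmc, hm⟩ := exists_sqrt_inverse hr
  set T := P + (P - r * V) with hT
  have hT0 : 0 ≤ T := add_nonneg hP.nonneg hQ.nonneg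
  have hrT : r * T = T * r := by
    rw [hT]
    calc r * (P + (P - r * V)) = r * P + (r * P - r * (r * V)) := by noncomm_ring
      _ = (P + (P - r * V)) * r := by rw [hrP, hrV, ← mul_assoc, hrV]; noncomm_ring
  have hmT : m * (T + r) = (T + r) * m := hmc _ (by rw [mul_add, add_mul, hrT])
  have hTT : T * T = 2 * T - r * r := by
    calc T * T = 4 * (P * P) - 2 * (P * r * V) - 2 * (r * (V * P)) + r * (V * r) * V := by
          rw [hT]; noncomm_ring
      _ = 4 * P - 2 * (r * (P * V + V * P)) + r * (r * (V * V)) := by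
          rw [hPP, ← hrP, ← hrV]; noncomm_ring
      _ = 2 * T - r * r := by rw [hanti, hrVV, hT]; noncomm_ring
  have hsq : (T + r) * (T + r) = 2 * (1 + r) * T := by
    calc (T + r) * (T + r) = T * T + T * r + r * T + r * r := by noncomm_ring
      _ = 2 * (1 + r) * T := by rw [hTT, ← hrT]; noncomm_ring
  have hsqrt : CFC.sqrt T = m * (T + r) := by
    refine CFC.sqrt_unique ?_ (Commute.mul_nonneg hm0 (add_nonneg hT0 hr) hmT)
    calc m * (T + r) * (m * (T + r)) = m * ((T + r) * m) * (T + r) := by noncomm_ring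
      _ = m * m * ((T + r) * (T + r)) := by rw [← hmT]; noncomm_ring
      _ = m * m * (2 * (1 + r)) * T := by rw [hsq]; noncomm_ring
      _ = T := by rw [hm, one_mul]
  have hPVP : P * V * P = r * P := by
    have h : P * V * P + P * V * P = r * P + P * V * P := by
      calc P * V * P + P * V * P = P * P * V * P + P * V * (P * P) := by rw [hPP]
        _ = P * (P * V + V * P) * P := by noncomm_ring
        _ = P * r * P + P * V * P := by rw [hanti]; noncomm_ring
        _ = r * P + P * V * P := by rw [← hrP, mul_assoc r, hPP]
    exact add_right_cancel h
  have hkey : (T + r) * ((1 + V) * P) = 2 * (1 + r) * P := by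
    calc (T + r) * ((1 + V) * P)
        = 2 * (P * P) + 2 * (P * V * P) + r * P - r * (V * V) * P := by rw [hT]; noncomm_ring
      _ = 2 * (1 + r) * P := by rw [hPP, hPVP, hrVV]; noncomm_ring
  refine ⟨m * ((1 + V) * P), ?_⟩
  calc CFC.sqrt T * (m * ((1 + V) * P)) = m * ((T + r) * m) * ((1 + V) * P) := by
        rw [hsqrt]; noncomm_ring
    _ = m * m * ((T + r) * ((1 + V) * P)) := by rw [← hmT]; noncomm_ring
    _ = m * m * (2 * (1 + r)) * P := by rw [hkey]; noncomm_ring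
    _ = P := by rw [hm, one_mul]

/-! ### Removing small angles -/

/-- The projection `Q' = P - r * V` is obtained from `Q` by cutting off small angles to `P`, with
`r = sin θ'` and `V` the sign of `P - Q'`, both built by functional calculus from `z = (P - Q)²`. -/
lemma exists_near_projection_sqrt_mul_eq {P Q : B} (hP : IsStarProjection P)
    (hQ : IsStarProjection Q) {ε : ℝ} (hε0 : 0 < ε) (hε1 : ε < 1) :
    ∃ Q' : B, IsStarProjection Q' ∧ ‖Q - Q'‖ < ε ∧ ∃ X : B, CFC.sqrt (P + Q') * X = P := by
  have hPP : P * P = P := hP.isIdempotentElem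
  obtain ⟨d, hd, hd2, hdε⟩ : ∃ d : ℝ, 0 < d ∧ d ≤ 1 / 2 ∧ 2 * d + 2 * d < ε :=
    ⟨ε / 8, by linarith, by linarith, by linarith⟩
  set D := P - Q with hD
  set J := 2 * P - 1 with hJ
  set z := D * D with hz
  have hDs : IsSelfAdjoint D := hP.isSelfAdjoint.sub hQ.isSelfAdjoint
  have hJU : J ∈ unitary B := hP.two_mul_sub_one_mem_unitary
  have hJs : IsSelfAdjoint J := by
    rw [hJ, two_mul]; exact (hP.isSelfAdjoint.add hP.isSelfAdjoint).sub (.one B)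
  have hzs : IsSelfAdjoint z := by rw [hz]; exact hDs.commute_iff hDs |>.1 rfl
  have hz1 : z ≤ 1 := by
    have hS : IsSelfAdjoint (P + Q - 1) := (hP.isSelfAdjoint.add hQ.isSelfAdjoint).sub (.one B)
    rw [← sub_mul_sub_add_mul_self hP.isIdempotentElem hQ.isIdempotentElem]
    exact le_add_of_nonneg_right hS.mul_self_nonneg
  have hspec : ∀ t ∈ spectrum ℝ z, t ≤ 1 :=
    (cfc_le_one_iff (fun t : ℝ => t) z).1 (by rwa [cfc_id' ℝ z])
  have hzP : z * P = P * z := commute_sub_mul_sub hP.isIdempotentElem hQ.isIdempotentElem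
  have hPD : P * D + D * P = z + D :=
    mul_sub_add_sub_mul hP.isIdempotentElem hQ.isIdempotentElem
  have hzJ : z * J = J * z := by
    rw [hJ]
    calc z * (2 * P - 1) = 2 * (z * P) - z := by noncomm_ring
      _ = (2 * P - 1) * z := by rw [hzP]; noncomm_ring
  have hzD : z * D = D * z := mul_assoc D D D
  have hJD : J * D + D * J = 2 * z := by
    calc J * D + D * J = 2 * (P * D + D * P) - 2 * D := by rw [hJ]; noncomm_ring
      _ = 2 * z := by rw [hPD]; noncomm_ring
  have hJJ : J * J = 1 := by
    have := hJU.1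
    rwa [hJs.star_eq] at this
  have hPJ : P * J = P := by
    calc P * J = 2 * (P * P) - P := by rw [hJ]; noncomm_ring
      _ = P := by rw [hPP]; noncomm_ring
  have hJP : J * P = P := by
    calc J * P = 2 * (P * P) - P := by rw [hJ]; noncomm_ring
      _ = P := by rw [hPP]; noncomm_ring
  have hb0 : Continuous (offDiagScale d) := continuous_offDiagScale hd (by linarith)
  have hcomm : ∀ (f : ℝ → ℝ) {a : B}, z * a = a * z → cfc f z * a = a * cfc f z := fun f a ha =>
    (Commute.cfc_real (show Commute z a from ha) f).eq
  have hzid : cfc (fun t : ℝ => t) z = z := cfc_id' ℝ z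
  set r := cfc (sineCutoff d) z with hr
  set b := cfc (offDiagScale d) z with hb
  set e := cfc (fun t => sineCutoff d t - offDiagScale d t * t) z with he
  have hrs : IsSelfAdjoint r := cfc_predicate _ _
  have hbs : IsSelfAdjoint b := cfc_predicate _ _
  have hes : IsSelfAdjoint e := cfc_predicate _ _
  have hrnn : 0 ≤ r := cfc_nonneg fun t _ => sineCutoff_nonneg d t
  have hebz : e = r - b * z := by
    rw [he, cfc_sub _ _ z (by fun_prop) (by fun_prop),
      cfc_mul (offDiagScale d) (fun t => t) z (by fun_prop) (by fun_prop), hzid]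
  have hrP : r * P = P * r := hcomm _ hzP
  have hbP : b * P = P * b := hcomm _ hzP
  have heP : e * P = P * e := hcomm _ hzP
  have hrD : r * D = D * r := hcomm _ hzD
  have hrJ : r * J = J * r := hcomm _ hzJ
  have hrz : r * z = z * r := hcomm _ rfl
  have hbz : b * z = z * b := hcomm _ rfl
  have hbD : b * D = D * b := hcomm _ hzD
  have heD : e * D = D * e := hcomm _ hzD
  have hbJ : b * J = J * b := hcomm _ hzJ
  have heJ : e * J = J * e := hcomm _ hzJ
  have hrb : r * b = b * r := hcomm _ (hcomm _ rfl).symm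
  have hre : r * e = e * r := hcomm _ (hcomm _ rfl).symm
  have hbe : b * e = e * b := hcomm _ (hcomm _ rfl).symm
  -- `e` is chosen so that `P V + V P = r + V`, which forces `r = b z + e`
  set V := b * D + e * J with hV
  have hVs : IsSelfAdjoint V :=
    (hbs.commute_iff hDs |>.1 hbD).add (hes.commute_iff hJs |>.1 heJ)
  have hrV : r * V = V * r := by
    calc r * V = r * b * D + r * e * J := by rw [hV]; noncomm_ring
      _ = b * (r * D) + e * (r * J) := by rw [hrb, hre]; noncomm_ring
      _ = V * r := by rw [hrD, hrJ, hV]; noncomm_ring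
  have hanti : P * V + V * P = r + V := by
    calc P * V + V * P = P * b * D + P * e * J + b * (D * P) + e * (J * P) := by
          rw [hV]; noncomm_ring
      _ = b * (P * D + D * P) + e * (P * J + J * P) := by
          rw [← hbP, ← heP]; noncomm_ring
      _ = b * z + e + b * D + e * (2 * P - 1) := by rw [hPD, hPJ, hJP]; noncomm_ring
      _ = r + V := by rw [← hJ, hebz, hV, hebz]; noncomm_ring
  have hVV : V * V = b * b * (z - z * z) + r * r := by
    calc V * V = b * (D * b) * D + b * (D * e) * J + e * (J * b) * D + e * (J * e) * J := by
          rw [hV]; noncomm_ring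
      _ = b * b * z + b * e * (J * D + D * J) + e * e * (J * J) := by
          rw [← hbD, ← heD, ← hbJ, ← heJ]
          calc _ = b * b * (D * D) + b * e * (D * J) + e * b * (J * D) + e * e * (J * J) := by
                noncomm_ring
            _ = _ := by rw [← hbe]; noncomm_ring
      _ = b * b * z + 2 * (b * e * z) + e * e := by rw [hJD, hJJ]; noncomm_ring
      _ = b * b * z + b * r * z + b * (r * z) - b * (b * z) * z - b * (b * z) * z
            + (r * r - r * b * z - b * (z * r) + b * (z * b) * z) := by
          rw [hebz]; noncomm_ring
      _ = b * b * (z - z * z) + r * r := by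
          rw [← hrz, ← hbz, hrb]
          noncomm_ring
  -- `r` annihilates the part of the spectrum of `z` on which `V² = 1` fails
  have hrVV : r * (V * V) = r := by
    have h1 : r * (V * V) = cfc (fun t => sineCutoff d t *
        (offDiagScale d t ^ 2 * (t - t ^ 2) + sineCutoff d t ^ 2)) z := by
      rw [cfc_mul _ _ z (by fun_prop) (by fun_prop), cfc_add z _ _ (by fun_prop) (by fun_prop),
        cfc_mul _ _ z (by fun_prop) (by fun_prop), cfc_pow _ 2 z (by fun_prop),
        cfc_pow _ 2 z (by fun_prop), cfc_sub _ _ z (by fun_prop) (by fun_prop),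
        cfc_pow _ 2 z (by fun_prop), hzid, hVV, pow_two, pow_two, pow_two]
    rw [h1]
    exact cfc_congr fun t _ => sineCutoff_mul_sq hd (by linarith) t
  refine ⟨P - r * V, isStarProjection_sub_mul_of_anticommutator hP hVs hrs hrP hrV
    hanti hrVV, ?_, exists_sqrt_mul_eq hP hVs hrnn hrP hrV hanti hrVV⟩
  set g := cfc (fun t => sineCutoff d t * offDiagScale d t - 1) z with hg
  have hgs : IsSelfAdjoint g := cfc_predicate _ _
  have hgrb : g = r * b - 1 := by
    rw [hg, cfc_sub _ _ z (by fun_prop) (by fun_prop), cfc_mul _ _ z (by fun_prop) (by fun_prop),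
      cfc_const_one ℝ z]
  have hdiff : Q - (P - r * V) = g * D + r * e * J := by
    rw [hgrb, hV, hD]; noncomm_ring
  have hn1 : ‖g * D‖ ≤ 2 * d := by
    have h1 : ‖g * D‖ * ‖g * D‖ ≤ (2 * d) ^ 2 := by
      rw [← CStarRing.norm_star_mul_self, star_mul, hgs.star_eq, hDs.star_eq]
      have h2 : D * g * (g * D) =
          cfc (fun t => (sineCutoff d t * offDiagScale d t - 1) ^ 2 * t) z := by
        rw [cfc_mul _ _ z (by fun_prop) (by fun_prop), cfc_pow _ 2 z (by fun_prop), hzid,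
          ← hcomm _ hzD, mul_assoc, ← mul_assoc D, ← hcomm _ hzD, pow_two, hz]
        noncomm_ring
      rw [h2]
      refine norm_cfc_le (by positivity) fun t ht => ?_
      have ht0 : 0 ≤ t := spectrum_nonneg_of_nonneg hDs.mul_self_nonneg ht
      rw [Real.norm_of_nonneg (by positivity)]
      exact sq_sineCutoff_mul_offDiagScale_sub_one_mul_le hd hd2 (hspec t ht)
    exact abs_le_of_sq_le_sq' (by rwa [pow_two ‖_‖]) (by positivity) |>.2
  have hn2 : ‖r * e * J‖ ≤ 2 * d := by
    rw [CStarRing.norm_mul_mem_unitary _ hJU, hr, he, ← cfc_mul _ _ z (by fun_prop) (by fun_prop)]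
    exact norm_cfc_le (by positivity) fun t ht => abs_sineCutoff_mul_sub_le hd hd2 (hspec t ht)
  calc ‖Q - (P - r * V)‖ ≤ ‖g * D‖ + ‖r * e * J‖ := by rw [hdiff]; exact norm_add_le _ _
    _ < ε := by linarith

end PerturbedProjection

theorem theorem3p2 {A E : Type*} [NonUnitalCStarAlgebra A] [PartialOrder A] [StarOrderedRing A]
    [NormedAddCommGroup E] [NormedSpace ℂ E] [SMul A E] [CStarModule A E] [CompleteSpace E]
    (P Q : AdjointableOp A E) (hP : IsStarProjection P) (hQ : IsStarProjection Q)
    (ε : ℝ) (hε : ε ∈ Set.Ioo (0 : ℝ) 1) :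
    ∃ Q' : AdjointableOp A E, IsStarProjection Q' ∧ ‖Q - Q'‖ < ε ∧
      ∃ X : AdjointableOp A E, CFC.sqrt (P + Q') * X = P :=
  exists_near_projection_sqrt_mul_eq hP hQ hε.1 hε.2
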